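/- For $\xi\in\mathbb{R}$ let $\mu(\xi)\in[1,\infty]$ be its irrationality exponent, i.e. the supremum of all real $\mu$ such that $|\xi-p/q|\le q^{-\mu}$ holds for infinitely many rational numbers $p/q$ (in lowest terms, $q\ge 1$). For $\lambda\in[2,\infty]$ let $\mathscr{W}_\lambda=\{\xi\in\mathbb{R}:\mu(\xi)=\lambda\}$, and let $\dim$ denote Hausdorff dimension. Let $\lambda_0,\lambda_1$ be real numbers with $\min\{\lambda_0,\lambda_1\}>\frac{5+\sqrt{17}}{2}$. Then \[ 1+\frac{2}{\max\{\lambda_0,\lambda_1\}}\;\ge\;\dim(\mathscr{W}_{\lambda_0}\times\mathscr{W}_{\lambda_1})\;\ge\;1=\max\Big\{1,\ \frac{2}{\lambda_0}+\frac{2}{\lambda_1}\Big\}. \] Moreover, for every $\lambda\in\big(\frac{5+\sqrt{17}}{2},\infty\big]$ we have \[ \dim(\mathscr{W}_\lambda\times\mathscr{W}_\lambda)\;\ge\;1\;>\;2\dim(\mathscr{W}_\lambda). \] -/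

import Mathlib

/-- The irrationality exponent of a real number `ξ`: the supremum, in the extended reals, of the
real `μ` such that `|ξ - p/q| ≤ q ^ (-μ)` holds for infinitely many rational numbers `p/q`
(written in lowest terms with `q > 0`). It equals `1` at rational `ξ`, is at least `2` at
irrational `ξ`, and is `⊤` exactly at the Liouville numbers. -/
noncomputable def irrationalityExponent (ξ : ℝ) : EReal :=
  ⨆ (μ : ℝ) (_ : {r : ℚ | |ξ - (r : ℝ)| ≤ (r.den : ℝ) ^ (-μ)}.Infinite), (μ : EReal)

/-- The set of real numbers whose irrationality exponent is exactly `l`. -/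
def exponentLevelSet (l : EReal) : Set ℝ :=
  {ξ : ℝ | irrationalityExponent ξ = l}

open Set Filter Topology MeasureTheory
open scoped NNReal ENNReal

theorem hausdorffMeasure_eq_zero_of_frequently_mem {X α : Type*} [MetricSpace X]
    [MeasurableSpace X] [BorelSpace X] [Countable α] {d : ℝ} (hd : 0 ≤ d) {E : Set X}
    (J : ℕ → Finset α) (U : ℕ → α → Set X) (δ : ℕ → ℝ) (hδ : ∀ q, 0 ≤ δ q)
    (hδ0 : Tendsto δ atTop (𝓝 0))
    (hU : ∀ q, ∀ j ∈ J q, Metric.ediam (U q j) ≤ ENNReal.ofReal (δ q))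
    (hsum : Summable fun q => ((J q).card : ℝ) * δ q ^ d)
    (hE : ∀ x ∈ E, ∃ᶠ q in atTop, ∃ j ∈ J q, x ∈ U q j) :
    Measure.hausdorffMeasure d E = 0 := by
  set r : ℕ → ℝ≥0∞ := fun n => ⨆ q ≥ n, ENNReal.ofReal (δ q) with hr
  have hr0 : Tendsto r atTop (𝓝 0) := by
    have h1 : Antitone r := fun m n hmn =>
      iSup₂_le fun q hq => le_iSup₂_of_le q (hmn.trans hq) le_rfl
    have h2 : ⨅ n, r n = 0 := by
      rw [hr, ← limsup_eq_iInf_iSup_of_nat]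
      have := ENNReal.tendsto_ofReal hδ0
      rw [ENNReal.ofReal_zero] at this
      exact this.limsup_eq
    exact h2 ▸ tendsto_atTop_iInf h1
  have key := Measure.hausdorffMeasure_le_liminf_tsum (X := X) (ι := fun n => Σ k : ℕ, J (k + n))
    d E (l := atTop) r hr0 (fun n i => U (i.1 + n) i.2)
    (Eventually.of_forall fun n i => (hU _ _ i.2.2).trans
      (le_iSup₂_of_le (i.1 + n) (Nat.le_add_left _ _) le_rfl))
    (Eventually.of_forall fun n x hx => by
      obtain ⟨q, hq, j, hj, hxj⟩ := (frequently_atTop.1 (hE x hx)) n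
      obtain ⟨k, rfl⟩ := Nat.exists_eq_add_of_le' hq
      exact mem_iUnion.2 ⟨⟨k, j, hj⟩, hxj⟩)
  refine le_antisymm (key.trans ?_) zero_le
  set g : ℕ → ℝ≥0∞ := fun q => ENNReal.ofReal (((J q).card : ℝ) * δ q ^ d)
  have hg : ∑' q, g q ≠ ∞ := hsum.tsum_ofReal_ne_top
  have hlim := (ENNReal.tendsto_sum_nat_add g hg).liminf_eq
  rw [← hlim]
  refine liminf_le_liminf (Eventually.of_forall fun n => ?_)
  rw [ENNReal.tsum_sigma']
  refine ENNReal.tsum_le_tsum fun k => ?_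
  calc ∑' j : J (k + n), Metric.ediam (U (k + n) j) ^ d
      ≤ ∑' j : J (k + n), ENNReal.ofReal (δ (k + n)) ^ d :=
        ENNReal.tsum_le_tsum fun j => ENNReal.rpow_le_rpow (hU _ _ j.2) hd
    _ = g (k + n) := by
        rw [tsum_fintype, Finset.sum_const, Finset.card_univ, Fintype.card_coe, nsmul_eq_mul,
          ENNReal.ofReal_rpow_of_nonneg (hδ _) hd, ← ENNReal.ofReal_natCast,
          ← ENNReal.ofReal_mul (Nat.cast_nonneg _)]

theorem ediam_closedBall_le_ofReal {X : Type*} [PseudoMetricSpace X] (x : X) {r : ℝ} (hr : 0 ≤ r) :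
    Metric.ediam (Metric.closedBall x r) ≤ ENNReal.ofReal (2 * r) :=
  Metric.ediam_le fun y hy z hz => by
    rw [edist_le_ofReal (by positivity)]
    have h := dist_triangle_right y z x
    rw [Metric.mem_closedBall] at hy hz
    linarith

theorem finite_rat_den_le_abs_sub_le (ξ C : ℝ) (n : ℕ) :
    {r : ℚ | r.den ≤ n ∧ |ξ - r| ≤ C}.Finite := by
  set M : ℤ := ⌈(|ξ| + C) * n⌉
  refine Set.Finite.of_injOn (f := fun r : ℚ => (r.num, r.den)) (t := Icc (-M) M ×ˢ Iic n) ?_ ?_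
    ((finite_Icc _ _).prod (finite_Iic _))
  · rintro r ⟨h1, h2⟩
    refine ⟨?_, h1⟩
    have hr : |(r : ℝ)| ≤ |ξ| + C := by
      have := abs_sub_abs_le_abs_sub (r : ℝ) ξ
      rw [abs_sub_comm] at this
      linarith
    have hd : (0 : ℝ) < r.den := by exact_mod_cast r.den_pos
    have hnum : (r.num : ℝ) = r * r.den := by
      exact_mod_cast (Rat.mul_den_eq_num r).symm
    have : |(r.num : ℝ)| ≤ M := by
      rw [hnum, abs_mul, abs_of_pos hd]
      refine le_trans ?_ (Int.le_ceil _)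
      have hn : (r.den : ℝ) ≤ n := by exact_mod_cast h1
      exact mul_le_mul hr hn hd.le ((abs_nonneg _).trans hr)
    exact abs_le.1 (by exact_mod_cast this)
  · intro r _ s _ h
    simp only [Prod.mk.injEq] at h
    exact Rat.ext h.1 h.2

/-- The real numbers approximable to order `τ` by infinitely many rationals. -/
def approximableSet (τ : ℝ) : Set ℝ :=
  {ξ : ℝ | {r : ℚ | |ξ - (r : ℝ)| ≤ (r.den : ℝ) ^ (-τ)}.Infinite}

theorem mem_approximableSet_of_lt_irrationalityExponent {τ ξ : ℝ}
    (h : (τ : EReal) < irrationalityExponent ξ) : ξ ∈ approximableSet τ := by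
  simp only [irrationalityExponent, lt_iSup_iff, EReal.coe_lt_coe_iff] at h
  obtain ⟨μ, hμ, hlt⟩ := h
  refine Set.Infinite.mono (fun r hr => ?_) hμ
  refine le_trans (mem_ofPred.1 hr) ?_
  exact Real.rpow_le_rpow_of_exponent_le (by exact_mod_cast r.den_pos) (by linarith)

theorem frequently_exists_int_of_mem_approximableSet {τ ξ : ℝ} (hτ : 0 ≤ τ)
    (h : ξ ∈ approximableSet τ) :
    ∃ᶠ q : ℕ in atTop, 1 ≤ q ∧ ∃ p : ℤ, |ξ - p / q| ≤ (q : ℝ) ^ (-τ) := by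
  rw [frequently_atTop]
  intro n
  obtain ⟨r, hr, hrn⟩ := (h.sdiff (finite_rat_den_le_abs_sub_le ξ 1 n)).nonempty
  have h1 : (1 : ℝ) ≤ r.den := by exact_mod_cast r.den_pos
  have hr' : |ξ - (r : ℝ)| ≤ (r.den : ℝ) ^ (-τ) := hr
  have hle : |ξ - (r : ℝ)| ≤ 1 :=
    hr'.trans (Real.rpow_le_one_of_one_le_of_nonpos h1 (by linarith))
  have hn : n < r.den := by
    by_contra hcon
    exact hrn ⟨not_lt.1 hcon, hle⟩
  refine ⟨r.den, hn.le, r.den_pos, r.num, ?_⟩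
  rwa [← Rat.cast_def]

theorem abs_int_le_of_abs_sub_div_le {ξ : ℝ} {N q : ℕ} {p : ℤ} (hq : 1 ≤ q) (hξ : |ξ| ≤ N)
    (h : |ξ - p / q| ≤ 1) : p ∈ Finset.Icc (-((N + 1 : ℤ) * q)) ((N + 1) * q) := by
  have hq' : (0 : ℝ) < q := by exact_mod_cast hq
  have h1 : |(p : ℝ) / q| ≤ N + 1 := by
    have := abs_sub_abs_le_abs_sub ((p : ℝ) / q) ξ
    rw [abs_sub_comm] at this
    linarith
  rw [abs_div, abs_of_pos hq', div_le_iff₀ hq'] at h1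
  rw [Finset.mem_Icc]
  exact abs_le.1 (by exact_mod_cast h1)

theorem card_Icc_neg_le {M : ℤ} {x : ℝ} (hM : 0 ≤ M) (h : 2 * (M : ℝ) + 1 ≤ x) :
    ((Finset.Icc (-M) M).card : ℝ) ≤ x := by
  rw [Int.card_Icc]
  have : (((M + 1 - -M).toNat : ℤ) : ℝ) = 2 * M + 1 := by
    rw [Int.toNat_of_nonneg (by omega)]; push_cast; ring
  rw [← Int.cast_natCast, this]; exact h

theorem dimH_approximableSet_le {τ : ℝ} (hτ : 0 < τ) :
    dimH (approximableSet τ) ≤ ENNReal.ofReal (2 / τ) := by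
  have hU : approximableSet τ ⊆ ⋃ N : ℕ, approximableSet τ ∩ {ξ | |ξ| ≤ N} := fun ξ hξ =>
    mem_iUnion.2 ⟨⌈|ξ|⌉₊, hξ, mem_ofPred.2 (Nat.le_ceil _)⟩
  refine (dimH_mono hU).trans ?_
  rw [dimH_iUnion]
  refine iSup_le fun N => dimH_le fun d hd => ?_
  by_contra! hlt
  rw [ENNReal.ofReal_lt_coe_iff (by positivity), div_lt_iff₀ hτ] at hlt
  suffices h : Measure.hausdorffMeasure (d : ℝ) (approximableSet τ ∩ {ξ | |ξ| ≤ N}) = 0 by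
    simp [h] at hd
  refine hausdorffMeasure_eq_zero_of_frequently_mem d.2
    (fun q => Finset.Icc (-((N + 1 : ℤ) * q)) ((N + 1) * q))
    (fun q p => Metric.closedBall ((p : ℝ) / q) ((q : ℝ) ^ (-τ)))
    (fun q => 2 * (q : ℝ) ^ (-τ)) (fun q => by positivity) ?_ ?_ ?_ ?_
  · simpa using ((tendsto_rpow_neg_atTop hτ).comp tendsto_natCast_atTop_atTop).const_mul 2
  · intro q p _
    exact ediam_closedBall_le_ofReal _ (by positivity)
  · refine Summable.of_norm_bounded_eventually_nat
      (g := fun q : ℕ => (2 * N + 3) * 2 ^ (d : ℝ) * (q : ℝ) ^ (1 - τ * d)) ?_ ?_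
    · exact (Real.summable_nat_rpow.2 (by linarith)).mul_left _
    · filter_upwards [eventually_ge_atTop 1] with q hq
      have hq' : (1 : ℝ) ≤ q := by exact_mod_cast hq
      have hq0 : (0 : ℝ) < q := by linarith
      rw [Real.norm_of_nonneg (by positivity), Real.mul_rpow (by norm_num) (by positivity),
        ← Real.rpow_mul hq0.le]
      have hcard : ((Finset.Icc (-((N + 1 : ℤ) * q)) ((N + 1) * q)).card : ℝ) ≤ (2 * N + 3) * q :=
        card_Icc_neg_le (by positivity) (by push_cast; nlinarith)
      have hpow : (q : ℝ) ^ (1 - τ * d) = q * (q : ℝ) ^ (-τ * d) := by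
        rw [show 1 - τ * d = 1 + -τ * d by ring, Real.rpow_add hq0, Real.rpow_one]
      rw [hpow]
      calc _ ≤ (2 * N + 3) * q * (2 ^ (d : ℝ) * (q : ℝ) ^ (-τ * d)) :=
            mul_le_mul_of_nonneg_right hcard (by positivity)
        _ = _ := by ring
  · rintro ξ ⟨hξ, hN⟩
    refine (frequently_exists_int_of_mem_approximableSet hτ.le hξ).mono ?_
    rintro q ⟨hq, p, hp⟩
    have hq' : (1 : ℝ) ≤ q := by exact_mod_cast hq
    refine ⟨p, abs_int_le_of_abs_sub_div_le hq hN
      (hp.trans (Real.rpow_le_one_of_one_le_of_nonpos hq' (by linarith))), ?_⟩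
    rwa [Metric.mem_closedBall, Real.dist_eq]

theorem dimH_approximableSet_prod_univ_le {τ : ℝ} (hτ : 0 < τ) :
    dimH (approximableSet τ ×ˢ (univ : Set ℝ)) ≤ 1 + ENNReal.ofReal (2 / τ) := by
  have hU : approximableSet τ ×ˢ (univ : Set ℝ) ⊆
      ⋃ N : ℕ, (approximableSet τ ×ˢ univ) ∩ {z : ℝ × ℝ | |z.1| ≤ N ∧ |z.2| ≤ N} := fun z hz =>
    mem_iUnion.2 ⟨⌈max |z.1| |z.2|⌉₊, hz, (le_max_left _ _).trans (Nat.le_ceil _),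
      (le_max_right _ _).trans (Nat.le_ceil _)⟩
  refine (dimH_mono hU).trans ?_
  rw [dimH_iUnion]
  refine iSup_le fun N => dimH_le fun d hd => ?_
  by_contra! hlt
  rw [← ENNReal.ofReal_one, ← ENNReal.ofReal_add zero_le_one (by positivity),
    ENNReal.ofReal_lt_coe_iff (by positivity)] at hlt
  have hlt' : τ + 2 < τ * d := by
    have := mul_lt_mul_of_pos_left hlt hτ
    field_simp at this
    linarith
  suffices h : Measure.hausdorffMeasure (d : ℝ)
      ((approximableSet τ ×ˢ univ) ∩ {z : ℝ × ℝ | |z.1| ≤ N ∧ |z.2| ≤ N}) = 0 by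
    simp [h] at hd
  refine hausdorffMeasure_eq_zero_of_frequently_mem d.2
    (fun q => Finset.Icc (-((N + 1 : ℤ) * q)) ((N + 1) * q) ×ˢ
      Finset.Icc (-(⌈N * (q : ℝ) ^ τ⌉ + 1)) (⌈N * (q : ℝ) ^ τ⌉ + 1))
    (fun q p => Metric.closedBall ((p.1 : ℝ) / q, (p.2 : ℝ) * (q : ℝ) ^ (-τ)) ((q : ℝ) ^ (-τ)))
    (fun q => 2 * (q : ℝ) ^ (-τ)) (fun q => by positivity) ?_ ?_ ?_ ?_
  · simpa using ((tendsto_rpow_neg_atTop hτ).comp tendsto_natCast_atTop_atTop).const_mul 2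
  · intro q p _
    exact ediam_closedBall_le_ofReal _ (by positivity)
  · refine Summable.of_norm_bounded_eventually_nat (g := fun q : ℕ =>
      (2 * N + 3) * (2 * N + 5) * 2 ^ (d : ℝ) * (q : ℝ) ^ (1 + τ - τ * d)) ?_ ?_
    · exact (Real.summable_nat_rpow.2 (by linarith)).mul_left _
    · filter_upwards [eventually_ge_atTop 1] with q hq
      have hq' : (1 : ℝ) ≤ q := by exact_mod_cast hq
      have hq0 : (0 : ℝ) < q := by linarith
      rw [Real.norm_of_nonneg (by positivity), Real.mul_rpow (by norm_num) (by positivity),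
        ← Real.rpow_mul hq0.le, Finset.card_product]
      have hcard : ((Finset.Icc (-((N + 1 : ℤ) * q)) ((N + 1) * q)).card : ℝ) ≤ (2 * N + 3) * q :=
        card_Icc_neg_le (by positivity) (by push_cast; nlinarith)
      have h1 : 1 ≤ (q : ℝ) ^ τ := Real.one_le_rpow hq' hτ.le
      have hcard' : ((Finset.Icc (-(⌈N * (q : ℝ) ^ τ⌉ + 1)) (⌈N * (q : ℝ) ^ τ⌉ + 1)).card : ℝ) ≤
          (2 * N + 5) * (q : ℝ) ^ τ := by
        refine card_Icc_neg_le (by positivity) ?_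
        have := (Int.ceil_lt_add_one (N * (q : ℝ) ^ τ)).le
        push_cast
        nlinarith
      have hpow : (q : ℝ) ^ (1 + τ - τ * d) = q * (q : ℝ) ^ τ * (q : ℝ) ^ (-τ * d) := by
        rw [show 1 + τ - τ * d = 1 + τ + -τ * d by ring, Real.rpow_add hq0, Real.rpow_add hq0,
          Real.rpow_one]
      rw [hpow, Nat.cast_mul]
      calc _ ≤ (2 * N + 3) * q * ((2 * N + 5) * (q : ℝ) ^ τ) *
            (2 ^ (d : ℝ) * (q : ℝ) ^ (-τ * d)) :=
            mul_le_mul_of_nonneg_right (mul_le_mul hcard hcard' (by positivity) (by positivity))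
              (by positivity)
        _ = _ := by ring
  · rintro ⟨ξ, y⟩ ⟨⟨hξ, -⟩, hN, hyN⟩
    refine (frequently_exists_int_of_mem_approximableSet hτ.le hξ).mono ?_
    rintro q ⟨hq, p, hp⟩
    have hq' : (1 : ℝ) ≤ q := by exact_mod_cast hq
    have hq0 : (0 : ℝ) < q := by linarith
    have hpos : 0 < (q : ℝ) ^ τ := by positivity
    refine ⟨(p, ⌊y * (q : ℝ) ^ τ⌋), Finset.mem_product.2 ⟨abs_int_le_of_abs_sub_div_le hq hN
      (hp.trans (Real.rpow_le_one_of_one_le_of_nonpos hq' (by linarith))), ?_⟩, ?_⟩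
    · have hy : |y * (q : ℝ) ^ τ| ≤ N * (q : ℝ) ^ τ := by
        rw [abs_mul, abs_of_pos hpos]
        exact mul_le_mul_of_nonneg_right hyN hpos.le
      have hc := Int.le_ceil (N * (q : ℝ) ^ τ)
      have hf := Int.floor_le (y * (q : ℝ) ^ τ)
      have hf' := Int.lt_floor_add_one (y * (q : ℝ) ^ τ)
      rw [abs_le] at hy
      rw [Finset.mem_Icc]
      constructor
      · have : (-(⌈N * (q : ℝ) ^ τ⌉ + 1 : ℤ) : ℝ) ≤ ⌊y * (q : ℝ) ^ τ⌋ := by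
          push_cast; linarith [hy.1]
        exact_mod_cast this
      · have : (⌊y * (q : ℝ) ^ τ⌋ : ℝ) ≤ (⌈N * (q : ℝ) ^ τ⌉ + 1 : ℤ) := by
          push_cast; linarith [hy.2]
        exact_mod_cast this
    · rw [← closedBall_prod_same]
      refine ⟨by rwa [Metric.mem_closedBall, Real.dist_eq], ?_⟩
      rw [Metric.mem_closedBall, Real.dist_eq]
      have hyq : y = y * (q : ℝ) ^ τ * (q : ℝ) ^ (-τ) := by
        rw [Real.rpow_neg hq0.le, mul_assoc, mul_inv_cancel₀ hpos.ne', mul_one]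
      have hneg : 0 ≤ (q : ℝ) ^ (-τ) := by positivity
      change |y - (⌊y * (q : ℝ) ^ τ⌋ : ℝ) * (q : ℝ) ^ (-τ)| ≤ _
      nth_rw 1 [hyq]
      rw [← sub_mul, abs_mul, abs_of_nonneg hneg]
      refine mul_le_of_le_one_left hneg ?_
      rw [Int.self_sub_floor, Int.abs_fract]
      exact (Int.fract_lt_one _).le

theorem exponentLevelSet_subset_approximableSet {l : EReal} {τ : ℝ} (h : (τ : EReal) < l) :
    exponentLevelSet l ⊆ approximableSet τ := fun _ hξ =>
  mem_approximableSet_of_lt_irrationalityExponent (h.trans_eq (Eq.symm hξ))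

theorem dimH_exponentLevelSet_prod_le {l : ℝ} (hl : 0 < l) (B : Set ℝ) :
    dimH (exponentLevelSet (l : EReal) ×ˢ B) ≤ 1 + ENNReal.ofReal (2 / l) := by
  have hlim : Tendsto (fun τ : ℝ => 1 + ENNReal.ofReal (2 / τ)) (𝓝[<] l)
      (𝓝 (1 + ENNReal.ofReal (2 / l))) := by
    refine tendsto_const_nhds.add (ENNReal.tendsto_ofReal ?_)
    exact (tendsto_const_nhds.div tendsto_id hl.ne').mono_left nhdsWithin_le_nhds
  refine ge_of_tendsto hlim ?_
  filter_upwards [Ioo_mem_nhdsLT hl] with τ hτ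
  exact (dimH_mono (prod_mono (exponentLevelSet_subset_approximableSet
    (EReal.coe_lt_coe_iff.2 hτ.2)) (subset_univ _))).trans (dimH_approximableSet_prod_univ_le hτ.1)

theorem dimH_prod_comm (A B : Set ℝ) : dimH (A ×ˢ B) = dimH (B ×ˢ A) := by
  have key : ∀ A B : Set ℝ, dimH (A ×ˢ B) ≤ dimH (B ×ˢ A) := fun A B => by
    have h : LipschitzWith 1 (Prod.swap : ℝ × ℝ → ℝ × ℝ) := LipschitzWith.mk_one fun x y => by
      rw [Prod.dist_eq, Prod.dist_eq, max_comm]; rfl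
    rw [← image_swap_prod]
    exact h.dimH_image_le _
  exact le_antisymm (key A B) (key B A)

theorem one_le_dimH_prod_of_volume_ne_zero {A B T : Set ℝ} (hT : volume T ≠ 0)
    (h : ∀ t ∈ T, ∃ x ∈ A, ∃ y ∈ B, x + y = t) : 1 ≤ dimH (A ×ˢ B) := by
  have hlip : LipschitzWith 2 fun z : ℝ × ℝ => z.1 + z.2 := by
    have := LipschitzWith.prod_fst.add (LipschitzWith.prod_snd (α := ℝ) (β := ℝ)) (α := ℝ × ℝ)
    rwa [one_add_one_eq_two] at this
  have hsub : T ⊆ (fun z : ℝ × ℝ => z.1 + z.2) '' (A ×ˢ B) := fun t ht => by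
    obtain ⟨x, hx, y, hy, rfl⟩ := h t ht
    exact ⟨(x, y), ⟨hx, hy⟩, rfl⟩
  calc (1 : ℝ≥0∞) = ((1 : ℝ≥0) : ℝ≥0∞) := by simp
    _ ≤ dimH T := le_dimH_of_hausdorffMeasure_ne_zero (by simpa using hT)
    _ ≤ dimH ((fun z : ℝ × ℝ => z.1 + z.2) '' (A ×ˢ B)) := dimH_mono hsub
    _ ≤ dimH (A ×ˢ B) := hlip.dimH_image_le _

theorem Liouville.irrationalityExponent_eq_top {ξ : ℝ} (h : Liouville ξ) :
    irrationalityExponent ξ = ⊤ := by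
  rw [EReal.eq_top_iff_forall_lt]
  intro y
  obtain ⟨n, hn⟩ := exists_nat_gt (max y 0)
  have hyn : y < n := (le_max_left _ _).trans_lt hn
  have hn0 : 0 < n := by exact_mod_cast (le_max_right _ _).trans_lt hn
  refine lt_of_lt_of_le (EReal.coe_lt_coe_iff.2 hyn) (le_iSup₂_of_le (n : ℝ) ?_ le_rfl)
  by_contra hfin
  rw [Set.not_infinite] at hfin
  have hev : ∀ᶠ b : ℕ in atTop, ∀ r ∈ {r : ℚ | |ξ - (r : ℝ)| ≤ (r.den : ℝ) ^ (-(n : ℝ))},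
      1 / (b : ℝ) ^ n < |ξ - r| := by
    rw [eventually_all_finite hfin]
    intro r _
    have hpos : 0 < |ξ - r| := abs_pos.2 (sub_ne_zero.2 (h.irrational.ne_rat r))
    have hlim : Tendsto (fun b : ℕ => 1 / (b : ℝ) ^ n) atTop (𝓝 0) := by
      simp only [one_div]
      exact ((tendsto_pow_atTop hn0.ne').comp
        (tendsto_natCast_atTop_atTop (R := ℝ))).inv_tendsto_atTop
    exact hlim.eventually_lt_const hpos
  obtain ⟨b, ⟨a, -, hab⟩, hb, hb1⟩ :=
    ((h.frequently_exists_num n).and_eventually (hev.and (eventually_ge_atTop 1))).exists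
  set r : ℚ := (a : ℚ) / b with hr
  have hrR : (r : ℝ) = a / b := by simp [hr]
  rw [← hrR] at hab
  have hden : r.den ≤ b := by
    have : (r.den : ℤ) ∣ b := by
      have := Rat.den_dvd a b
      rwa [show (Rat.divInt a b) = r by rw [Rat.divInt_eq_div]; simp [hr]] at this
    exact Nat.le_of_dvd hb1 (by exact_mod_cast this)
  have hmem : |ξ - (r : ℝ)| ≤ (r.den : ℝ) ^ (-(n : ℝ)) := by
    refine hab.le.trans ?_
    rw [Real.rpow_neg (by positivity), Real.rpow_natCast, one_div]
    have h0 : (0 : ℝ) < r.den := by exact_mod_cast r.den_pos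
    have h1 : (r.den : ℝ) ≤ b := by exact_mod_cast hden
    gcongr
  exact lt_asymm hab (hb r hmem)

theorem one_le_dimH_exponentLevelSet_top_prod :
    1 ≤ dimH (exponentLevelSet ⊤ ×ˢ exponentLevelSet ⊤) := by
  refine one_le_dimH_prod_of_volume_ne_zero (T := univ) (by simp) fun t _ => ?_
  have h1 : {x : ℝ | Liouville x} ∈ residual ℝ := eventually_residual_liouville
  have h2 : {x : ℝ | Liouville (t - x)} ∈ residual ℝ := by
    have h := (Homeomorph.subLeft t).residual_map_eq
    have h3 : (Homeomorph.subLeft t) ⁻¹' {x : ℝ | Liouville x} ∈ residual ℝ := by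
      rw [← Filter.mem_map, h]; exact h1
    exact h3
  obtain ⟨x, hx, hx'⟩ := (dense_of_mem_residual (inter_mem h1 h2)).nonempty
  exact ⟨x, Liouville.irrationalityExponent_eq_top hx, t - x,
    Liouville.irrationalityExponent_eq_top hx', by ring⟩

/-- A dyadic number with odd numerator and denominator `2 ^ (n + 1)`, exceeding `x` by an amount
comparable to `2 ^ (-n)`. -/
noncomputable def dyadicUpper (n : ℕ) (x : ℝ) : ℝ := (2 * ⌊2 ^ n * x⌋ + 3) / 2 ^ (n + 1)

theorem dyadicUpper_sub_self (n : ℕ) (x : ℝ) :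
    1 / 2 / 2 ^ n ≤ dyadicUpper n x - x ∧ dyadicUpper n x - x ≤ 3 / 2 / 2 ^ n := by
  have hw : (0 : ℝ) < 2 ^ n := by positivity
  have h1 := Int.floor_le ((2 : ℝ) ^ n * x)
  have h2 := (Int.lt_floor_add_one ((2 : ℝ) ^ n * x)).le
  have h : dyadicUpper n x - x = (⌊2 ^ n * x⌋ + 3 / 2 - 2 ^ n * x) / 2 ^ n := by
    rw [dyadicUpper, pow_succ]; field_simp
  rw [h]
  constructor <;> gcongr <;> linarith

theorem dyadicUpper_floor_div {m n : ℕ} (h : n ≤ m) (x : ℝ) :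
    dyadicUpper n (⌊(2 : ℝ) ^ m * x⌋ / 2 ^ m) = dyadicUpper n x := by
  obtain ⟨c, rfl⟩ := Nat.exists_eq_add_of_le h
  have e1 : (2 : ℝ) ^ n * (⌊(2 : ℝ) ^ (n + c) * x⌋ / 2 ^ (n + c)) =
      ⌊(2 : ℝ) ^ (n + c) * x⌋ / ((2 ^ c : ℕ) : ℝ) := by
    rw [pow_add]; push_cast; field_simp
  have e2 : (2 : ℝ) ^ n * x = (2 ^ (n + c) * x) / ((2 ^ c : ℕ) : ℝ) := by
    rw [pow_add]; push_cast; field_simp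
  unfold dyadicUpper
  rw [e1, e2, Int.floor_div_natCast, Int.floor_div_natCast, Int.floor_intCast]

theorem tendsto_dyadicUpper (x : ℝ) : Tendsto (fun n => dyadicUpper n x) atTop (𝓝 x) := by
  have h0 : Tendsto (fun n : ℕ => x + 3 / 2 / (2 : ℝ) ^ n) atTop (𝓝 x) := by
    have := (tendsto_pow_atTop_atTop_of_one_lt (one_lt_two (α := ℝ))).inv_tendsto_atTop.const_mul
      (3 / 2)
    simpa [div_eq_mul_inv] using this.const_add x
  refine tendsto_of_tendsto_of_tendsto_of_le_of_le tendsto_const_nhds h0 (fun n => ?_) fun n => ?_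
  · have := (dyadicUpper_sub_self n x).1
    have h : (0 : ℝ) ≤ 1 / 2 / 2 ^ n := by positivity
    change x ≤ dyadicUpper n x
    linarith
  · have := (dyadicUpper_sub_self n x).2
    change dyadicUpper n x ≤ _
    linarith

/-- Blocks of binary positions `[a k, b k)`, the gap after the `k`-th block being `l` times as long
as its end point, up to bounded error. -/
structure IsBlockSequence (l : ℝ) (a b : ℕ → ℕ) : Prop where
  left_lt (k : ℕ) : a k + 2 ≤ b k
  right_lt (k : ℕ) : b k + 2 ≤ a (k + 1)
  le_left (k : ℕ) : l * (b k + 1) + 2 ≤ a (k + 1)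
  left_le (k : ℕ) : a (k + 1) ≤ l * (b k + 1) + 4

/-- The contribution of one block to `blockSum`. -/
noncomputable def blockTerm (a b : ℕ → ℕ) (x : ℝ) (k : ℕ) : ℝ :=
  dyadicUpper (a k) x - dyadicUpper (b k) x

/-- The number whose binary digits are essentially those of `x` in the blocks, and constant
elsewhere. -/
noncomputable def blockSum (a b : ℕ → ℕ) (x : ℝ) : ℝ := ∑' k, blockTerm a b x k

/-- The contribution to `blockSum` of the blocks up to the `k`-th. -/
noncomputable def blockPartial (a b : ℕ → ℕ) (x : ℝ) (k : ℕ) : ℝ :=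
  ∑ j ∈ Finset.range (k + 1), blockTerm a b x j

theorem exists_int_div_two_pow {n n' : ℕ} (h : n < n') (m : ℤ) :
    ∃ m' : ℤ, (m : ℝ) / 2 ^ n = (2 * m' : ℤ) / 2 ^ n' := by
  obtain ⟨c, rfl⟩ := Nat.exists_eq_add_of_lt h
  refine ⟨m * 2 ^ c, ?_⟩
  rw [pow_add, pow_add]
  push_cast
  field_simp

namespace IsBlockSequence

variable {l : ℝ} {a b : ℕ → ℕ}

theorem left_add_le (h : IsBlockSequence l a b) (k j : ℕ) : a k + j ≤ a (k + j) := by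
  induction j with
  | zero => simp
  | succ j ih =>
    have h1 := h.left_lt (k + j)
    have h2 := h.right_lt (k + j)
    rw [← add_assoc k j 1]
    omega

theorem strictMono_right (h : IsBlockSequence l a b) : StrictMono b :=
  strictMono_nat_of_lt_succ fun k => by
    have h1 := h.left_lt (k + 1)
    have h2 := h.right_lt k
    omega

theorem blockTerm_bounds (h : IsBlockSequence l a b) (x : ℝ) (k : ℕ) :
    1 / 8 / 2 ^ a k ≤ blockTerm a b x k ∧ blockTerm a b x k ≤ 3 / 2 / 2 ^ a k := by
  have h1 := dyadicUpper_sub_self (a k) x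
  have h2 := dyadicUpper_sub_self (b k) x
  have h3 : 3 / 2 / (2 : ℝ) ^ b k ≤ 3 / 2 / 2 ^ (a k + 2) := by
    gcongr
    · norm_num
    · exact h.left_lt k
  have h4 : 3 / 2 / (2 : ℝ) ^ (a k + 2) = 3 / 8 / 2 ^ a k := by
    rw [pow_add]; field_simp; norm_num
  have h5 : 1 / 2 / (2 : ℝ) ^ a k = 1 / 8 / 2 ^ a k + 3 / 8 / 2 ^ a k := by
    field_simp; norm_num
  have h6 : (0 : ℝ) ≤ 1 / 2 / 2 ^ b k := by positivity
  unfold blockTerm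
  constructor
  · linarith [h1.1, h2.2]
  · linarith [h1.2, h2.1]

theorem blockTerm_nonneg (h : IsBlockSequence l a b) (x : ℝ) (k : ℕ) : 0 ≤ blockTerm a b x k :=
  le_trans (by positivity) (h.blockTerm_bounds x k).1

theorem blockTerm_add_le (h : IsBlockSequence l a b) (x : ℝ) (k j : ℕ) :
    blockTerm a b x (j + k) ≤ 3 / 2 / 2 ^ a k * (1 / 2) ^ j := by
  refine (h.blockTerm_bounds x _).2.trans ?_
  rw [add_comm, one_div_pow, ← div_eq_mul_one_div, div_div _ ((2 : ℝ) ^ a k), ← pow_add]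
  gcongr
  · norm_num
  · exact h.left_add_le k j

theorem summable_blockTerm (h : IsBlockSequence l a b) (x : ℝ) : Summable (blockTerm a b x) :=
  Summable.of_nonneg_of_le (h.blockTerm_nonneg x) (fun j => h.blockTerm_add_le x 0 j)
    (summable_geometric_two.mul_left _)

theorem tail_bounds (h : IsBlockSequence l a b) (x : ℝ) (k : ℕ) :
    1 / 8 / 2 ^ a k ≤ ∑' j, blockTerm a b x (j + k) ∧
      ∑' j, blockTerm a b x (j + k) ≤ 3 / 2 ^ a k := by
  have hs := (summable_nat_add_iff k).2 (h.summable_blockTerm x)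
  constructor
  · refine (h.blockTerm_bounds x k).1.trans ?_
    have := hs.le_tsum 0 fun j _ => h.blockTerm_nonneg x (j + k)
    rwa [zero_add] at this
  · refine (hs.tsum_le_tsum (h.blockTerm_add_le x k) (summable_geometric_two.mul_left _)).trans
      (le_of_eq ?_)
    rw [tsum_mul_left, tsum_geometric_two]
    ring

theorem blockSum_sub_blockPartial (h : IsBlockSequence l a b) (x : ℝ) (k : ℕ) :
    blockSum a b x - blockPartial a b x k = ∑' j, blockTerm a b x (j + (k + 1)) := by
  rw [blockSum, blockPartial, ← (h.summable_blockTerm x).sum_add_tsum_nat_add (k + 1)]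
  ring

theorem rpow_le_two_pow (h : IsBlockSequence l a b) (k : ℕ) :
    4 * ((2 : ℝ) ^ (b k + 1)) ^ l ≤ 2 ^ a (k + 1) := by
  rw [← Real.rpow_natCast, ← Real.rpow_natCast, ← Real.rpow_mul (by norm_num),
    show (4 : ℝ) = 2 ^ (2 : ℝ) by norm_num, ← Real.rpow_add (by norm_num)]
  refine Real.rpow_le_rpow_of_exponent_le (by norm_num) ?_
  have := h.le_left k
  push_cast
  linarith

theorem two_pow_le_rpow (h : IsBlockSequence l a b) (k : ℕ) :
    (2 : ℝ) ^ a (k + 1) ≤ 16 * ((2 : ℝ) ^ (b k + 1)) ^ l := by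
  rw [← Real.rpow_natCast, ← Real.rpow_natCast, ← Real.rpow_mul (by norm_num),
    show (16 : ℝ) = 2 ^ (4 : ℝ) by norm_num, ← Real.rpow_add (by norm_num)]
  refine Real.rpow_le_rpow_of_exponent_le (by norm_num) ?_
  have := h.left_le k
  push_cast
  linarith

theorem blockSum_sub_blockPartial_bounds (h : IsBlockSequence l a b) (x : ℝ) (k : ℕ) :
    1 / 128 * ((2 : ℝ) ^ (b k + 1)) ^ (-l) ≤ blockSum a b x - blockPartial a b x k ∧
      blockSum a b x - blockPartial a b x k ≤ ((2 : ℝ) ^ (b k + 1)) ^ (-l) := by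
  rw [h.blockSum_sub_blockPartial, Real.rpow_neg (by positivity)]
  have h1 := h.tail_bounds x (k + 1)
  have h2 := h.rpow_le_two_pow k
  have h3 := h.two_pow_le_rpow k
  have hQ : 0 < ((2 : ℝ) ^ (b k + 1)) ^ l := by positivity
  constructor
  · refine le_trans ?_ h1.1
    rw [div_div, ← div_eq_mul_inv, div_div]
    exact one_div_le_one_div_of_le (by positivity) (by linarith)
  · refine h1.2.trans ?_
    rw [← one_div, div_le_div_iff₀ (by positivity) hQ]
    linarith

theorem exists_blockPartial_eq_odd_div (h : IsBlockSequence l a b) (x : ℝ) (k : ℕ) :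
    ∃ m : ℤ, blockPartial a b x k = ((2 * m + 1 : ℤ) : ℝ) / 2 ^ (b k + 1) := by
  have hterm : ∀ k, ∃ m : ℤ, blockTerm a b x k = ((2 * m + 1 : ℤ) : ℝ) / 2 ^ (b k + 1) := by
    intro k
    obtain ⟨m, hm⟩ := exists_int_div_two_pow (n := a k + 1) (n' := b k + 1)
      (by have := h.left_lt k; omega) (2 * ⌊(2 : ℝ) ^ a k * x⌋ + 3)
    refine ⟨m - ⌊(2 : ℝ) ^ b k * x⌋ - 2, ?_⟩
    push_cast at hm
    unfold blockTerm dyadicUpper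
    rw [hm]
    push_cast
    ring
  induction k with
  | zero => simpa [blockPartial] using hterm 0
  | succ k ih =>
    obtain ⟨m, hm⟩ := ih
    obtain ⟨m₁, hm₁⟩ := hterm (k + 1)
    obtain ⟨m₂, hm₂⟩ := exists_int_div_two_pow (n := b k + 1) (n' := b (k + 1) + 1)
      (by have := h.strictMono_right (Nat.lt_succ_self k); simpa using this) (2 * m + 1)
    refine ⟨m₁ + m₂, ?_⟩
    rw [blockPartial, Finset.sum_range_succ, ← blockPartial, hm, hm₂, hm₁]
    push_cast
    ring

theorem exists_rat_eq_blockPartial (h : IsBlockSequence l a b) (x : ℝ) (k : ℕ) :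
    ∃ r : ℚ, (r : ℝ) = blockPartial a b x k ∧ r.den = 2 ^ (b k + 1) := by
  obtain ⟨m, hm⟩ := h.exists_blockPartial_eq_odd_div x k
  refine ⟨((2 * m + 1 : ℤ) : ℚ) / ((2 ^ (b k + 1) : ℤ) : ℚ), ?_, ?_⟩
  · rw [hm]; push_cast; rfl
  · have := Rat.den_div_eq_of_coprime (a := 2 * m + 1) (b := 2 ^ (b k + 1)) (by positivity) (by
      rw [Int.natAbs_pow]
      refine Nat.Coprime.pow_right _ ?_
      have : Odd (2 * m + 1).natAbs := Int.natAbs_odd.2 (odd_two_mul_add_one m)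
      exact this.coprime_two_right)
    exact_mod_cast this

theorem le_irrationalityExponent (h : IsBlockSequence l a b) (x : ℝ) :
    (l : EReal) ≤ irrationalityExponent (blockSum a b x) := by
  refine le_iSup₂_of_le l ?_ le_rfl
  choose r hr hden using h.exists_rat_eq_blockPartial x
  refine Set.infinite_of_injective_forall_mem (f := r) (fun i j hij => ?_) fun k => ?_
  · have := congrArg Rat.den hij
    rw [hden, hden] at this
    have := Nat.pow_right_injective le_rfl this
    exact h.strictMono_right.injective (by omega)
  · have hb := h.blockSum_sub_blockPartial_bounds x k
    rw [mem_ofPred, hr, hden, abs_of_nonneg (le_trans (by positivity) hb.1)]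
    exact_mod_cast hb.2

end IsBlockSequence

theorem one_div_den_mul_den_le_abs_sub {r s : ℚ} (h : r ≠ s) :
    1 / ((r.den : ℝ) * s.den) ≤ |(r : ℝ) - s| := by
  have hr : (0 : ℝ) < r.den := by exact_mod_cast r.den_pos
  have hs : (0 : ℝ) < s.den := by exact_mod_cast s.den_pos
  have e : (r : ℝ) - s = ((r.num * s.den - s.num * r.den : ℤ) : ℝ) / (r.den * s.den) := by
    nth_rw 1 [Rat.cast_def r, Rat.cast_def s]
    push_cast
    field_simp
  have hne : r.num * s.den - s.num * r.den ≠ 0 := by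
    intro h0
    rw [h0, Int.cast_zero, zero_div, sub_eq_zero] at e
    exact h (by exact_mod_cast e)
  rw [e, abs_div, abs_of_pos (mul_pos hr hs)]
  gcongr
  exact_mod_cast Int.one_le_abs hne

/-- The points `x` for which `blockSum a b x` may have a good rational approximation different from
the partial sums, with denominator too large to be excluded by comparison with the `k`-th one. -/
def exceptionalSet (l : ℝ) (a b : ℕ → ℕ) (k : ℕ) : Set ℝ :=
  {x | x ∈ Ico (0 : ℝ) 1 ∧ ∃ r : ℚ, ((2 : ℝ) ^ (b k + 1)) ^ (l - 1) < 2 * r.den ∧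
    |blockPartial a b x k + dyadicUpper (a (k + 1)) x - x - r| ≤ 9 * (r.den : ℝ) ^ (1 - l)}

namespace IsBlockSequence

variable {l : ℝ} {a b : ℕ → ℕ}

theorem abs_blockSum_sub_le (h : IsBlockSequence l a b) (hl : 1 ≤ l) (x : ℝ) (k : ℕ) :
    |blockSum a b x - (blockPartial a b x k + dyadicUpper (a (k + 1)) x - x)| ≤
      4 / 2 ^ (b (k + 1) + 1) := by
  have h1 := h.blockSum_sub_blockPartial_bounds x (k + 1)
  have h2 := dyadicUpper_sub_self (b (k + 1)) x
  have h3 : blockPartial a b x (k + 1) =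
      blockPartial a b x k + (dyadicUpper (a (k + 1)) x - dyadicUpper (b (k + 1)) x) := by
    rw [blockPartial, Finset.sum_range_succ]; rfl
  have h4 : ((2 : ℝ) ^ (b (k + 1) + 1)) ^ (-l) ≤ 1 / 2 ^ (b (k + 1) + 1) := by
    rw [one_div, ← Real.rpow_neg_one]
    exact Real.rpow_le_rpow_of_exponent_le (one_le_pow₀ (by norm_num)) (by linarith)
  have h5 : 3 / 2 / (2 : ℝ) ^ b (k + 1) = 3 / 2 ^ (b (k + 1) + 1) := by
    rw [pow_succ]; field_simp
  have h6 : 4 / (2 : ℝ) ^ (b (k + 1) + 1) =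
      3 / 2 ^ (b (k + 1) + 1) + 1 / 2 ^ (b (k + 1) + 1) := by ring
  have h7 : 0 ≤ 1 / 128 * ((2 : ℝ) ^ (b (k + 1) + 1)) ^ (-l) := by positivity
  have h8 : (0 : ℝ) ≤ 1 / 2 / 2 ^ b (k + 1) := by positivity
  have h9 : 0 ≤ 1 / (2 : ℝ) ^ (b (k + 1) + 1) := by positivity
  rw [abs_le]
  constructor
  · linarith [h1.1, h2.2]
  · linarith [h1.2, h2.1]

theorem irrationalityExponent_le (h : IsBlockSequence l a b) (hl : 2 < l) {x : ℝ}
    (hx : x ∈ Ico (0 : ℝ) 1) (hE : ∀ᶠ k in atTop, x ∉ exceptionalSet l a b k) :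
    irrationalityExponent (blockSum a b x) ≤ l := by
  refine iSup₂_le fun μ hμ => EReal.coe_le_coe_iff.2 ?_
  by_contra! hlt
  obtain ⟨K, hK⟩ := eventually_atTop.1 hE
  have hev : ∀ᶠ q : ℕ in atTop, 2 * (2 : ℝ) ^ (b K + 1) < (q : ℝ) ^ (l - 1) ∧
      128 < (q : ℝ) ^ (μ - l) :=
    (((tendsto_rpow_atTop (by linarith)).comp tendsto_natCast_atTop_atTop).eventually_gt_atTop
      _).and (((tendsto_rpow_atTop (by linarith)).comp
        tendsto_natCast_atTop_atTop).eventually_gt_atTop _)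
  obtain ⟨n, hn⟩ := eventually_atTop.1 hev
  obtain ⟨r, hr, hrn⟩ :=
    (hμ.sdiff (finite_rat_den_le_abs_sub_le (blockSum a b x) 1 n)).nonempty
  rw [mem_ofPred] at hr
  have hq1 : (1 : ℝ) ≤ r.den := by exact_mod_cast r.den_pos
  have hnq : n ≤ r.den := by
    by_contra! hcon
    exact hrn ⟨hcon.le, hr.trans (Real.rpow_le_one_of_one_le_of_nonpos hq1 (by linarith))⟩
  obtain ⟨hq2, hq3⟩ := hn _ hnq
  set q : ℝ := (r.den : ℝ) with hq
  have hq0 : 0 < q := by linarith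
  have hex : ∃ k, q ^ (l - 1) ≤ 2 * (2 : ℝ) ^ (b k + 1) := by
    obtain ⟨k, hk⟩ := pow_unbounded_of_one_lt (q ^ (l - 1)) (one_lt_two (α := ℝ))
    refine ⟨k, hk.le.trans ?_⟩
    rw [← pow_succ']
    have := h.strictMono_right.id_le k
    simp only [id] at this
    exact pow_le_pow_right₀ (by norm_num) (by omega)
  classical
  have hKk : K < Nat.find hex := by
    by_contra! hcon
    have h1 := Nat.find_spec hex
    have h2 : (2 : ℝ) ^ (b (Nat.find hex) + 1) ≤ 2 ^ (b K + 1) :=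
      pow_le_pow_right₀ (by norm_num) (by have := h.strictMono_right.monotone hcon; omega)
    linarith
  obtain ⟨k, hk⟩ := Nat.exists_eq_succ_of_ne_zero (Nat.ne_zero_of_lt hKk)
  have hk1 : 2 * (2 : ℝ) ^ (b k + 1) < q ^ (l - 1) := by
    have := Nat.find_min hex (m := k) (by omega)
    exact not_le.1 this
  have hk2 : q ^ (l - 1) ≤ 2 * (2 : ℝ) ^ (b (k + 1) + 1) := by
    have := Nat.find_spec hex
    rwa [hk] at this
  have hKk' : K ≤ k := by omega
  obtain ⟨s, hs, hsden⟩ := h.exists_rat_eq_blockPartial x k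
  have hsden' : (s.den : ℝ) = 2 ^ (b k + 1) := by rw [hsden]; push_cast; rfl
  have hb := h.blockSum_sub_blockPartial_bounds x k
  rw [← hs, ← hsden'] at hb
  rw [← hsden'] at hk1
  have hQ0 : (0 : ℝ) < s.den := by exact_mod_cast s.den_pos
  have hql : q ^ (-l) = 1 / (q * q ^ (l - 1)) := by
    rw [Real.rpow_neg hq0.le, one_div, Real.rpow_sub_one hq0.ne', mul_div_cancel₀ _ hq0.ne']
  have hqμ : q ^ (-μ) ≤ q ^ (-l) := Real.rpow_le_rpow_of_exponent_le hq1 (by linarith)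
  by_cases hrs : r = s
  · rw [← hrs] at hb
    rw [← hq] at hb
    have h1 : 1 / 128 * q ^ (-l) ≤ q ^ (-μ) := hb.1.trans ((le_abs_self _).trans hr)
    have h2 : q ^ (-l) = q ^ (-μ) * q ^ (μ - l) := by
      rw [← Real.rpow_add hq0]; congr 1; ring
    have h3 : 0 < q ^ (-μ) := by positivity
    rw [h2] at h1
    nlinarith
  have hsep := one_div_den_mul_den_le_abs_sub hrs
  rw [← hq] at hsep
  by_cases hlarge : ((2 : ℝ) ^ (b k + 1)) ^ (l - 1) < 2 * q
  · refine hK k hKk' ⟨hx, r, hlarge, ?_⟩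
    have h1 := h.abs_blockSum_sub_le (by linarith) x k
    have h2 : 4 / (2 : ℝ) ^ (b (k + 1) + 1) ≤ 8 * q ^ (1 - l) := by
      rw [show 1 - l = -(l - 1) by ring, Real.rpow_neg hq0.le, ← div_eq_mul_inv,
        div_le_div_iff₀ (by positivity) (by positivity)]
      linarith
    have h3 : q ^ (-μ) ≤ q ^ (1 - l) := Real.rpow_le_rpow_of_exponent_le hq1 (by linarith)
    rw [abs_sub_comm] at h1
    have := abs_sub_le (blockPartial a b x k + dyadicUpper (a (k + 1)) x - x) (blockSum a b x) r
    linarith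
  · rw [← hsden', not_lt] at hlarge
    have h1 : (s.den : ℝ) ^ (-l) ≤ 1 / (2 * (q * s.den)) := by
      rw [Real.rpow_neg hQ0.le, ← one_div]
      refine one_div_le_one_div_of_le (by positivity) ?_
      have : (s.den : ℝ) ^ l = s.den * (s.den : ℝ) ^ (l - 1) := by
        rw [Real.rpow_sub_one hQ0.ne', mul_div_cancel₀ _ hQ0.ne']
      rw [this]
      nlinarith
    have h2 : q ^ (-l) < 1 / (2 * (q * s.den)) := by
      rw [hql]
      refine one_div_lt_one_div_of_lt (by positivity) ?_
      nlinarith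
    have h3 : 1 / (q * s.den) = 1 / (2 * (q * s.den)) + 1 / (2 * (q * s.den)) := by
      field_simp; norm_num
    have h4 : 0 ≤ (s.den : ℝ) ^ (-l) := by positivity
    have h5 := abs_sub_le (r : ℝ) (blockSum a b x) s
    rw [abs_sub_comm (r : ℝ) (blockSum a b x), abs_of_nonneg (a := blockSum a b x - s)
      (le_trans (by positivity) hb.1)] at h5
    linarith [hb.2]

theorem blockPartial_floor_div (h : IsBlockSequence l a b) (x : ℝ) (k : ℕ) :
    blockPartial a b (⌊(2 : ℝ) ^ a (k + 1) * x⌋ / 2 ^ a (k + 1)) k = blockPartial a b x k := by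
  refine Finset.sum_congr rfl fun j hj => ?_
  have h1 : b j ≤ b k := h.strictMono_right.monotone (Nat.lt_succ_iff.1 (Finset.mem_range.1 hj))
  have h2 := h.right_lt k
  have h3 := h.left_lt j
  rw [blockTerm, dyadicUpper_floor_div (by omega), dyadicUpper_floor_div (by omega), blockTerm]

theorem abs_blockPartial_add_le (h : IsBlockSequence l a b) (x : ℝ) (k : ℕ) :
    |blockPartial a b x k + dyadicUpper (a (k + 1)) x - x| ≤ 5 := by
  have h1 := dyadicUpper_sub_self (a (k + 1)) x
  have h2 : 0 ≤ blockPartial a b x k := Finset.sum_nonneg fun j _ => h.blockTerm_nonneg x j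
  have h3 : blockPartial a b x k ≤ 3 := by
    refine ((h.summable_blockTerm x).sum_le_tsum _ fun j _ => h.blockTerm_nonneg x j).trans ?_
    refine (h.tail_bounds x 0).2.trans ?_
    rw [div_le_iff₀ (by positivity)]
    have : (1 : ℝ) ≤ 2 ^ a 0 := one_le_pow₀ (by norm_num)
    linarith
  have h4 : 3 / 2 / (2 : ℝ) ^ a (k + 1) ≤ 3 / 2 :=
    div_le_self (by norm_num) (one_le_pow₀ (by norm_num))
  have h5 : 0 ≤ 1 / 2 / (2 : ℝ) ^ a (k + 1) := by positivity
  rw [abs_le]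
  constructor <;> linarith [h1.1, h1.2]

open Classical in
theorem exceptionalSet_subset (h : IsBlockSequence l a b) (hl : 1 ≤ l) (k : ℕ) :
    exceptionalSet l a b k ⊆ ⋃ i ∈ Finset.Ico (0 : ℤ) (2 ^ a (k + 1)), ⋃ q : ℕ,
      ⋃ p ∈ (if ((2 : ℝ) ^ (b k + 1)) ^ (l - 1) < 2 * q then
        Finset.Icc (-(14 * q : ℤ)) (14 * q) else ∅),
      Metric.closedBall (blockPartial a b (i / 2 ^ a (k + 1)) k +
        dyadicUpper (a (k + 1)) (i / 2 ^ a (k + 1)) - p / q) (9 * (q : ℝ) ^ (1 - l)) := by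
  rintro x ⟨⟨hx0, hx1⟩, r, hr, hxr⟩
  have hw : (0 : ℝ) < 2 ^ a (k + 1) := by positivity
  have hi : ⌊(2 : ℝ) ^ a (k + 1) * x⌋ ∈ Finset.Ico (0 : ℤ) (2 ^ a (k + 1)) := by
    rw [Finset.mem_Ico, Int.floor_lt]
    refine ⟨Int.floor_nonneg.2 (by positivity), ?_⟩
    push_cast
    nlinarith
  have hq1 : (1 : ℝ) ≤ r.den := by exact_mod_cast r.den_pos
  have hp : r.num ∈ Finset.Icc (-(14 * r.den : ℤ)) (14 * r.den) := by
    have h1 := h.abs_blockPartial_add_le x k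
    have h2 : 9 * (r.den : ℝ) ^ (1 - l) ≤ 9 := by
      have := Real.rpow_le_one_of_one_le_of_nonpos hq1 (by linarith : 1 - l ≤ 0)
      linarith
    have h3 : |(r : ℝ)| ≤ 14 := by
      have := abs_sub_abs_le_abs_sub (r : ℝ)
        (blockPartial a b x k + dyadicUpper (a (k + 1)) x - x)
      rw [abs_sub_comm (r : ℝ)] at this
      linarith
    rw [Rat.cast_def, abs_div, abs_of_pos (by linarith : (0 : ℝ) < r.den),
      div_le_iff₀ (by linarith)] at h3
    rw [Finset.mem_Icc]
    exact abs_le.1 (by exact_mod_cast h3)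
  simp only [mem_iUnion]
  refine ⟨_, hi, r.den, r.num, by rwa [if_pos hr], ?_⟩
  rw [h.blockPartial_floor_div, dyadicUpper_floor_div le_rfl, Metric.mem_closedBall, Real.dist_eq,
    ← Rat.cast_def, abs_sub_comm]
  convert hxr using 2
  ring

open Classical in
theorem volume_exceptionalSet_le_mul_tsum (h : IsBlockSequence l a b) (hl : 1 ≤ l) (k : ℕ) :
    volume (exceptionalSet l a b k) ≤ 2 ^ a (k + 1) * ∑' q : ℕ,
      (if ((2 : ℝ) ^ (b k + 1)) ^ (l - 1) < 2 * q then
        ENNReal.ofReal (522 * (q : ℝ) ^ (2 - l)) else 0) := by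
  refine (measure_mono (h.exceptionalSet_subset hl k)).trans
    ((measure_biUnion_finset_le _ _).trans ?_)
  refine (Finset.sum_le_card_nsmul _ _ (∑' q : ℕ,
      (if ((2 : ℝ) ^ (b k + 1)) ^ (l - 1) < 2 * q then
        ENNReal.ofReal (522 * (q : ℝ) ^ (2 - l)) else 0)) fun i _ => ?_).trans (le_of_eq ?_)
  · refine (measure_iUnion_le _).trans (ENNReal.tsum_le_tsum fun q => ?_)
    refine (measure_biUnion_finset_le _ _).trans ?_
    split_ifs with hq
    · have hq0 : (0 : ℝ) < q := by
        have : 0 < ((2 : ℝ) ^ (b k + 1)) ^ (l - 1) := by positivity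
        linarith
      have hq1 : (1 : ℝ) ≤ q := by exact_mod_cast Nat.cast_pos.1 hq0
      simp only [Real.volume_closedBall, Finset.sum_const, nsmul_eq_mul]
      rw [← ENNReal.ofReal_natCast, ← ENNReal.ofReal_mul (Nat.cast_nonneg _)]
      refine ENNReal.ofReal_le_ofReal ?_
      have hc : ((Finset.Icc (-(14 * q : ℤ)) (14 * q)).card : ℝ) ≤ 29 * q :=
        card_Icc_neg_le (by positivity) (by push_cast; linarith)
      have he : (q : ℝ) ^ (2 - l) = q * (q : ℝ) ^ (1 - l) := by
        rw [show 2 - l = 1 + (1 - l) by ring, Real.rpow_add hq0, Real.rpow_one]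
      have hp : 0 ≤ (q : ℝ) ^ (1 - l) := by positivity
      calc _ ≤ 29 * q * (2 * (9 * (q : ℝ) ^ (1 - l))) :=
            mul_le_mul_of_nonneg_right hc (by positivity)
        _ = _ := by rw [he]; ring
    · simp
  · rw [Int.card_Ico, nsmul_eq_mul]
    congr 1
    have : (2 ^ a (k + 1) - 0 : ℤ).toNat = 2 ^ a (k + 1) := by
      rw [sub_zero, show (2 : ℤ) ^ a (k + 1) = ((2 ^ a (k + 1) : ℕ) : ℤ) by push_cast; rfl,
        Int.toNat_natCast]
    rw [this]
    push_cast
    rfl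

theorem exists_volume_exceptionalSet_le (h : IsBlockSequence l a b) (hl : 4 < l)
    (hl' : 0 < l ^ 2 - 5 * l + 2) : ∃ C : ℝ, ∀ k, volume (exceptionalSet l a b k) ≤
      ENNReal.ofReal (C * ((2 : ℝ) ^ (b k + 1)) ^ (-(l ^ 2 - 5 * l + 2))) := by
  classical
  set η : ℝ := 1 / (l - 1) with hη
  have hη0 : 0 < η := by rw [hη]; exact one_div_pos.2 (by linarith)
  set β : ℝ := l - 3 - η with hβ
  have hlβ : (l - 1) * β = l ^ 2 - 5 * l + 2 + l := by
    have : (l - 1) * η = 1 := by rw [hη]; field_simp [show l - 1 ≠ 0 by linarith]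
    rw [hβ]; linear_combination -this
  have hβ0 : 0 < β := by
    have : 0 < (l - 1) * β := by rw [hlβ]; linarith
    exact pos_of_mul_pos_right this (by linarith)
  have hsum : Summable fun q : ℕ => (q : ℝ) ^ (-1 - η) :=
    Real.summable_nat_rpow.2 (by linarith)
  set Z := ∑' q : ℕ, (q : ℝ) ^ (-1 - η)
  refine ⟨16 * (522 * 2 ^ β) * Z, fun k => ?_⟩
  set Q : ℝ := (2 : ℝ) ^ (b k + 1) with hQ
  have hQ0 : 0 < Q := by positivity
  have hZ : 0 ≤ Z := tsum_nonneg fun q => by positivity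
  have hT : 0 < Q ^ (l - 1) := by positivity
  calc volume (exceptionalSet l a b k) ≤ _ := h.volume_exceptionalSet_le_mul_tsum (by linarith) k
    _ ≤ 2 ^ a (k + 1) * ∑' q : ℕ,
        ENNReal.ofReal (522 * (Q ^ (l - 1) / 2) ^ (-β) * (q : ℝ) ^ (-1 - η)) := by
      gcongr with q
      split_ifs with hq
      · refine ENNReal.ofReal_le_ofReal ?_
        have hq0 : (0 : ℝ) < q := by linarith
        have h1 : (q : ℝ) ^ (2 - l) = (q : ℝ) ^ (-β) * (q : ℝ) ^ (-1 - η) := by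
          rw [← Real.rpow_add hq0]; congr 1; rw [hβ]; ring
        have h2 : (q : ℝ) ^ (-β) ≤ (Q ^ (l - 1) / 2) ^ (-β) :=
          Real.rpow_le_rpow_of_nonpos (by positivity) (by linarith) (by linarith)
        rw [h1, mul_assoc]
        gcongr
      · exact zero_le
    _ = ENNReal.ofReal (2 ^ a (k + 1) * (522 * (Q ^ (l - 1) / 2) ^ (-β) * Z)) := by
      rw [← ENNReal.ofReal_tsum_of_nonneg (fun q => by positivity) (hsum.mul_left _),
        tsum_mul_left, ENNReal.ofReal_mul (p := 2 ^ a (k + 1)) (by positivity),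
        ENNReal.ofReal_pow (by norm_num), ENNReal.ofReal_ofNat]
    _ ≤ _ := by
      refine ENNReal.ofReal_le_ofReal ?_
      have h1 := h.two_pow_le_rpow k
      rw [← hQ] at h1
      have h2 : Q ^ l * (Q ^ (l - 1) / 2) ^ (-β) = 2 ^ β * Q ^ (-(l ^ 2 - 5 * l + 2)) := by
        rw [Real.div_rpow hT.le (by norm_num), ← Real.rpow_mul hQ0.le,
          Real.rpow_neg (by norm_num : (0 : ℝ) ≤ 2), div_inv_eq_mul, ← mul_assoc,
          ← Real.rpow_add hQ0, mul_comm]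
        congr 2
        linear_combination -hlβ
      calc (2 : ℝ) ^ a (k + 1) * (522 * (Q ^ (l - 1) / 2) ^ (-β) * Z)
          ≤ 16 * Q ^ l * (522 * (Q ^ (l - 1) / 2) ^ (-β) * Z) :=
            mul_le_mul_of_nonneg_right h1 (by positivity)
        _ = 16 * 522 * Z * (Q ^ l * (Q ^ (l - 1) / 2) ^ (-β)) := by ring
        _ = _ := by rw [h2]; ring

theorem ae_irrationalityExponent_blockSum (h : IsBlockSequence l a b) (hl : 4 < l)
    (hl' : 0 < l ^ 2 - 5 * l + 2) :
    ∀ᵐ x : ℝ, x ∈ Ico (0 : ℝ) 1 → irrationalityExponent (blockSum a b x) = l := by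
  obtain ⟨C, hC⟩ := h.exists_volume_exceptionalSet_le hl hl'
  set ε := l ^ 2 - 5 * l + 2
  have hsum : Summable fun k => ((2 : ℝ) ^ (b k + 1)) ^ (-ε) := by
    have hlt : (2 : ℝ) ^ (-ε) < 1 := Real.rpow_lt_one_of_one_lt_of_neg (by norm_num) (by linarith)
    refine Summable.of_nonneg_of_le (fun k => by positivity) (fun k => ?_)
      (summable_geometric_of_lt_one (by positivity) hlt)
    rw [← Real.rpow_natCast, ← Real.rpow_natCast, ← Real.rpow_mul (by norm_num),
      ← Real.rpow_mul (by norm_num)]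
    refine Real.rpow_le_rpow_of_exponent_le (by norm_num) ?_
    have h1 : (k : ℝ) ≤ b k := by exact_mod_cast h.strictMono_right.id_le k
    push_cast
    nlinarith
  have hfin : ∑' k, volume (exceptionalSet l a b k) ≠ ∞ :=
    ne_top_of_le_ne_top (hsum.mul_left C).tsum_ofReal_ne_top (ENNReal.tsum_le_tsum hC)
  filter_upwards [ae_eventually_notMem hfin] with x hx hx01
  exact le_antisymm (h.irrationalityExponent_le (by linarith) hx01 hx)
    (h.le_irrationalityExponent x)

end IsBlockSequence

/-- The position following `n` when the digits between them are skipped. -/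
noncomputable def nextPosition (l : ℝ) (n : ℕ) : ℕ := ⌈l * (n + 1) + 2⌉₊

theorem le_nextPosition (l : ℝ) (n : ℕ) : l * (n + 1) + 2 ≤ nextPosition l n := Nat.le_ceil _

theorem nextPosition_le {l : ℝ} (hl : 0 ≤ l) (n : ℕ) : nextPosition l n ≤ l * (n + 1) + 4 := by
  have := (Nat.ceil_lt_add_one (a := l * (n + 1) + 2) (by positivity)).le
  unfold nextPosition
  linarith

theorem add_two_le_nextPosition {l : ℝ} (hl : 1 ≤ l) (n : ℕ) : n + 2 ≤ nextPosition l n := by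
  have h1 := le_nextPosition l n
  have h2 : (n : ℝ) + 2 ≤ nextPosition l n := by nlinarith [Nat.cast_nonneg (α := ℝ) n]
  exact_mod_cast h2

/-- Interlacing left end points of blocks for the exponents `l₀` and `l₁`. -/
noncomputable def blockStart (l₀ l₁ : ℝ) : ℕ → ℕ
  | 0 => 0
  | k + 1 => nextPosition l₀ (nextPosition l₁ (blockStart l₀ l₁ k))

theorem isBlockSequence_blockStart {l₀ l₁ : ℝ} (h₀ : 1 ≤ l₀) (h₁ : 1 ≤ l₁) :
    IsBlockSequence l₀ (blockStart l₀ l₁) fun k => nextPosition l₁ (blockStart l₀ l₁ k) where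
  left_lt _ := add_two_le_nextPosition h₁ _
  right_lt _ := add_two_le_nextPosition h₀ _
  le_left _ := le_nextPosition _ _
  left_le _ := nextPosition_le (by linarith) _

theorem isBlockSequence_blockStart_succ {l₀ l₁ : ℝ} (h₀ : 1 ≤ l₀) (h₁ : 1 ≤ l₁) :
    IsBlockSequence l₁ (fun k => nextPosition l₁ (blockStart l₀ l₁ k))
      fun k => blockStart l₀ l₁ (k + 1) where
  left_lt _ := add_two_le_nextPosition h₀ _
  right_lt _ := add_two_le_nextPosition h₁ _
  le_left _ := le_nextPosition _ _
  left_le _ := nextPosition_le (by linarith) _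

theorem blockSum_add_blockSum {l₀ l₁ : ℝ} {a b : ℕ → ℕ} (h₀ : IsBlockSequence l₀ a b)
    (h₁ : IsBlockSequence l₁ b fun k => a (k + 1)) (x : ℝ) :
    blockSum a b x + blockSum b (fun k => a (k + 1)) x = dyadicUpper (a 0) x - x := by
  have hs := (h₀.summable_blockTerm x).hasSum.add (h₁.summable_blockTerm x).hasSum
  refine tendsto_nhds_unique hs.tendsto_sum_nat ?_
  have hsum : ∀ n, ∑ i ∈ Finset.range n, (blockTerm a b x i + blockTerm b (fun k => a (k + 1)) x i)
      = dyadicUpper (a 0) x - dyadicUpper (a n) x := fun n => by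
    rw [← Finset.sum_range_sub' (fun n => dyadicUpper (a n) x)]
    refine Finset.sum_congr rfl fun i _ => ?_
    unfold blockTerm
    ring
  simp only [hsum]
  refine tendsto_const_nhds.sub ((tendsto_dyadicUpper x).comp ?_)
  refine tendsto_atTop_mono (fun n => ?_) tendsto_id
  have := h₀.left_add_le 0 n
  rw [zero_add] at this
  exact (Nat.le_add_left n (a 0)).trans this

theorem one_le_dimH_exponentLevelSet_prod {l₀ l₁ : ℝ} (h₀ : 4 < l₀) (h₁ : 4 < l₁)
    (h₀' : 0 < l₀ ^ 2 - 5 * l₀ + 2) (h₁' : 0 < l₁ ^ 2 - 5 * l₁ + 2) :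
    1 ≤ dimH (exponentLevelSet (l₀ : EReal) ×ˢ exponentLevelSet (l₁ : EReal)) := by
  have hb₀ := isBlockSequence_blockStart (l₀ := l₀) (l₁ := l₁) (by linarith) (by linarith)
  have hb₁ := isBlockSequence_blockStart_succ (l₀ := l₀) (l₁ := l₁) (by linarith) (by linarith)
  set a := blockStart l₀ l₁
  set b : ℕ → ℕ := fun k => nextPosition l₁ (a k)
  set T : Set ℝ := {t | ∃ x ∈ exponentLevelSet (l₀ : EReal),
    ∃ y ∈ exponentLevelSet (l₁ : EReal), x + y = t} with hT
  refine one_le_dimH_prod_of_volume_ne_zero (T := T) ?_ fun t ht => ht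
  have hae : ∀ᵐ x : ℝ, x ∈ Ico (0 : ℝ) 1 → 3 / 2 - x ∈ T := by
    filter_upwards [hb₀.ae_irrationalityExponent_blockSum h₀ h₀',
      hb₁.ae_irrationalityExponent_blockSum h₁ h₁'] with x hx₀ hx₁ hx
    refine ⟨_, hx₀ hx, _, hx₁ hx, ?_⟩
    rw [blockSum_add_blockSum hb₀ hb₁]
    have : ⌊x⌋ = 0 := Int.floor_eq_zero_iff.2 hx
    simp [a, blockStart, dyadicUpper, this]
  intro hT0
  have hpre : volume ((fun x : ℝ => 3 / 2 - x) ⁻¹' T) = 0 :=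
    (Measure.measurePreserving_sub_left volume (3 / 2 : ℝ)).quasiMeasurePreserving.preimage_null hT0
  have hle : volume (Ico (0 : ℝ) 1) ≤ volume ((fun x : ℝ => 3 / 2 - x) ⁻¹' T) :=
    measure_mono_ae hae
  rw [hpre] at hle
  simp at hle

theorem mainTheorem2 :
    (∀ l₀ l₁ : ℝ, (5 + √17) / 2 < min l₀ l₁ →
      dimH (exponentLevelSet (l₀ : EReal) ×ˢ exponentLevelSet (l₁ : EReal)) ≤
          1 + ENNReal.ofReal (2 / max l₀ l₁) ∧
      1 ≤ dimH (exponentLevelSet (l₀ : EReal) ×ˢ exponentLevelSet (l₁ : EReal)) ∧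
      (1 : ℝ) = max 1 (2 / l₀ + 2 / l₁)) ∧
    (∀ l : EReal, (((5 + √17) / 2 : ℝ) : EReal) < l →
      1 ≤ dimH (exponentLevelSet l ×ˢ exponentLevelSet l) ∧
      2 * dimH (exponentLevelSet l) < 1) := by
  have hsqrt : (4 : ℝ) ≤ √17 := Real.le_sqrt_of_sq_le (by norm_num)
  have hgt : ∀ l : ℝ, (5 + √17) / 2 < l → 4 < l ∧ 0 < l ^ 2 - 5 * l + 2 := fun l hl => by
    refine ⟨by linarith, ?_⟩
    have h1 : √17 ^ 2 = 17 := Real.sq_sqrt (by norm_num)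
    nlinarith
  constructor
  · intro l₀ l₁ h
    obtain ⟨h₀, h₀'⟩ := hgt l₀ (h.trans_le (min_le_left _ _))
    obtain ⟨h₁, h₁'⟩ := hgt l₁ (h.trans_le (min_le_right _ _))
    refine ⟨?_, one_le_dimH_exponentLevelSet_prod h₀ h₁ h₀' h₁', ?_⟩
    · rcases le_total l₀ l₁ with hle | hle
      · rw [max_eq_right hle, dimH_prod_comm]
        exact dimH_exponentLevelSet_prod_le (by linarith) _
      · rw [max_eq_left hle]
        exact dimH_exponentLevelSet_prod_le (by linarith) _
    · rw [max_eq_left]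
      have e₀ : 2 / l₀ ≤ 1 / 2 := by rw [div_le_div_iff₀ (by linarith) (by norm_num)]; linarith
      have e₁ : 2 / l₁ ≤ 1 / 2 := by rw [div_le_div_iff₀ (by linarith) (by norm_num)]; linarith
      linarith
  · intro l hl
    constructor
    · induction l with
      | bot => simp at hl
      | top => exact one_le_dimH_exponentLevelSet_top_prod
      | coe l =>
        obtain ⟨h₀, h₀'⟩ := hgt l (EReal.coe_lt_coe_iff.1 hl)
        exact one_le_dimH_exponentLevelSet_prod h₀ h₀ h₀' h₀'
    · have hτ : (0 : ℝ) < (5 + √17) / 2 := by positivity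
      have h1 := (dimH_mono (exponentLevelSet_subset_approximableSet hl)).trans
        (dimH_approximableSet_le hτ)
      calc 2 * dimH (exponentLevelSet l) ≤ 2 * ENNReal.ofReal (2 / ((5 + √17) / 2)) := by gcongr
        _ = ENNReal.ofReal (2 * (2 / ((5 + √17) / 2))) := by
          rw [ENNReal.ofReal_mul (by norm_num), ENNReal.ofReal_ofNat]
        _ < 1 := by
          rw [ENNReal.ofReal_lt_one, ← mul_div_assoc, div_lt_one hτ]
          linarith
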